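/- Let $(X,\rho)$ be any metric space (possibly nonseparable or noncomplete), $B(z,\varepsilon)$ its open balls, $B_b(X)$ the space of bounded Borel measurable real functions on $X$, $C_b(X)\subset B_b(X)$ the subspace of bounded continuous functions, and $\mathcal M_1$ the set of Borel probability measures on $X$. Let $(P_t)_{t\ge 0}$ be a stochastically continuous Markov–Feller semigroup, that is, a semigroup of linear operators on $B_b(X)$ (with $P_0=\mathrm{id}$, $P_{s+t}=P_sP_t$) such that - $P_t\mathbf 1_X=\mathbf 1_X$, and $P_t\varphi\ge 0$ whenever $\varphi\ge 0$; - $P_t(C_b(X))\subset C_b(X)$ for all $t\ge 0$; - there is a dual semigroup $P_t^*:\mathcal M_1\to\mathcal M_1$, $t\ge 0$, i.e. $\int_X P_t\varphi\,d\mu=\int_X\varphi\,d(P_t^*\mu)$ for all $\varphi\in B_b(X)$, $\mu\in\mathcal M_1$, $t\ge 0$; - $\lim_{t\to0^+}P_t\psi(x)=\psi(x)$ for all $\psi\in C_b(X)$ and $x\in X$. Suppose there are $z\in X$ and $\mu\in\mathcal M_1$ such that for every $\varepsilon>0$ $$\liminf_{t\to\infty}\frac1t\int_0^t P_s^*\mu(B(z,\varepsilon))\,ds>0.$$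 If for every $\varphi\in C_b(X)$ the family $(P_t\varphi)_{t\ge0}$ is equicontinuous at $z$, i.e. $\lim_{y\to z}\sup_{t\ge0}|P_t\varphi(y)-P_t\varphi(z)|=0$, then the semigroup has an invariant probability measure: there is $\mu_*\in\mathcal M_1$ with $P_t^*\mu_*=\mu_*$ for all $t\ge0$. -/

import Mathlib

open Filter Topology MeasureTheory
open scoped NNReal

/-- `Bb X`: the space of bounded Borel measurable real functions on `X`. -/
def Bb (X : Type*) [MeasurableSpace X] : Submodule ℝ (X → ℝ) where
  carrier := {f | Measurable f ∧ ∃ C : ℝ, ∀ x, |f x| ≤ C}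
  zero_mem' := ⟨measurable_const, 0, fun x => by simp⟩
  add_mem' := by
    rintro f g ⟨hf, C, hC⟩ ⟨hg, D, hD⟩
    exact ⟨hf.add hg, C + D, fun x =>
      (abs_add_le (f x) (g x)).trans (add_le_add (hC x) (hD x))⟩
  smul_mem' := by
    rintro c f ⟨hf, C, hC⟩
    refine ⟨hf.const_smul c, |c| * C, fun x => ?_⟩
    simpa [abs_mul] using mul_le_mul_of_nonneg_left (hC x) (abs_nonneg c)

instance (X : Type*) [MeasurableSpace X] : CoeFun (Bb X) (fun _ => X → ℝ) :=
  ⟨Subtype.val⟩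

/-- The constant function `1` as an element of `Bb X`. -/
def Bb.one (X : Type*) [MeasurableSpace X] : Bb X :=
  ⟨fun _ => 1, measurable_const, 1, fun _ => by simp⟩

/-- A Markov semigroup on `Bb X`: a semigroup of positive linear operators preserving `1`. -/
structure IsMarkovSemigroup {X : Type*} [MeasurableSpace X]
    (P : ℝ≥0 → Bb X →ₗ[ℝ] Bb X) : Prop where
  zero : P 0 = LinearMap.id
  add : ∀ s t, P (s + t) = P s ∘ₗ P t
  map_one : ∀ t, P t (Bb.one X) = Bb.one X
  nonneg : ∀ t (φ : Bb X), (∀ x, 0 ≤ φ x) → ∀ x, 0 ≤ P t φ x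

/-- `Pstar` is a semigroup on the Borel probability measures dual to `P`:
`⟨P_t φ, μ⟩ = ⟨φ, P_t^* μ⟩` for all bounded Borel `φ`. -/
structure IsDualSemigroup {X : Type*} [MeasurableSpace X]
    (P : ℝ≥0 → Bb X →ₗ[ℝ] Bb X)
    (Pstar : ℝ≥0 → ProbabilityMeasure X → ProbabilityMeasure X) : Prop where
  zero : ∀ μ, Pstar 0 μ = μ
  add : ∀ s t μ, Pstar (s + t) μ = Pstar s (Pstar t μ)
  duality : ∀ t (φ : Bb X) (μ : ProbabilityMeasure X),
    ∫ x, P t φ x ∂(μ : Measure X) = ∫ x, φ x ∂(Pstar t μ : Measure X)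

/-- A stochastically continuous Markov--Feller semigroup `P` with dual semigroup `Pstar`
(which is determined by `P`). -/
structure IsFellerSemigroup {X : Type*} [MetricSpace X] [MeasurableSpace X]
    (P : ℝ≥0 → Bb X →ₗ[ℝ] Bb X)
    (Pstar : ℝ≥0 → ProbabilityMeasure X → ProbabilityMeasure X) : Prop where
  markov : IsMarkovSemigroup P
  dual : IsDualSemigroup P Pstar
  feller : ∀ t (φ : Bb X), Continuous (φ : X → ℝ) → Continuous (P t φ : X → ℝ)
  stochCont : ∀ (ψ : Bb X), Continuous (ψ : X → ℝ) → ∀ x,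
    Tendsto (fun t => P t ψ x) (𝓝[>] 0) (𝓝 (ψ x))

/-! The invariant measure is a limit of the time averages of `P_s^* δ_z`. Without tightness, take
the limit along an ultrafilter: this gives a positive, normalized, `P`-invariant functional `Λ` on
`C_b(X)`, and the difficulty is to show that `Λ` is a measure. By a Daniell-type theorem
(`exists_probabilityMeasure`) it suffices that `Λ (φ n) → 0` when `φ n` decreases pointwise to zero,
which follows once `sup_t P_t (φ n) z → 0` (`exists_forall_toBCF_lt`).

If that fails, a gliding hump yields increments `f i ≥ 0` with bounded total sum and times `τ i`
such that `P_{τ i} (f i) z ≥ δ / 2`. Every subsum of the `f i` lies in `C_b(X)`, so a Baire category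
argument on `{0,1}^ℕ` makes the equicontinuity at `z` uniform in `i`
(`eventually_forall_abs_toBCF_sub_le`). Hence `P_{τ i} (f i) ≥ δ / 4` on one ball around `z` for all
`i`. The orbit of `μ` spends a positive fraction of time in that ball, so each `f i` receives a
fixed amount of averaged mass, contradicting the bounded sum (`not_forall_ball_le_toBCF`). -/

open scoped BoundedContinuousFunction ENNReal

/-! ### Representation of σ-continuous functionals by Borel measures. -/

namespace DaniellRepresentation

variable {X : Type*} [MetricSpace X]

/-- The premeasure of a set `A`: the infimum of `Λ φ` over nonnegative bounded continuous
functions `φ` that are at least `1` on `A`. -/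
noncomputable def premeasure (Λ : (X →ᵇ ℝ) →ₗ[ℝ] ℝ) (A : Set X) : ℝ≥0∞ :=
  ⨅ (φ : X →ᵇ ℝ) (_ : 0 ≤ φ ∧ ∀ x ∈ A, 1 ≤ φ x), ENNReal.ofReal (Λ φ)

theorem premeasure_le (Λ : (X →ᵇ ℝ) →ₗ[ℝ] ℝ) {A : Set X} {φ : X →ᵇ ℝ} (h0 : 0 ≤ φ)
    (h1 : ∀ x ∈ A, 1 ≤ φ x) : premeasure Λ A ≤ ENNReal.ofReal (Λ φ) :=
  iInf₂_le φ ⟨h0, h1⟩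

theorem premeasure_empty (Λ : (X →ᵇ ℝ) →ₗ[ℝ] ℝ) : premeasure Λ ∅ = 0 := by
  have := premeasure_le Λ (A := ∅) (φ := 0) le_rfl (by simp)
  simpa using this

/-- The outer measure generated by a functional on bounded continuous functions. -/
noncomputable def outerMeasure (Λ : (X →ᵇ ℝ) →ₗ[ℝ] ℝ) : OuterMeasure X :=
  OuterMeasure.ofFunction (premeasure Λ) (premeasure_empty Λ)

theorem outerMeasure_le (Λ : (X →ᵇ ℝ) →ₗ[ℝ] ℝ) {A : Set X} {φ : X →ᵇ ℝ} (h0 : 0 ≤ φ)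
    (h1 : ∀ x ∈ A, 1 ≤ φ x) : outerMeasure Λ A ≤ ENNReal.ofReal (Λ φ) :=
  (OuterMeasure.ofFunction_le A).trans (premeasure_le Λ h0 h1)

theorem map_mono {Λ : (X →ᵇ ℝ) →ₗ[ℝ] ℝ} (hΛ : ∀ φ, 0 ≤ φ → 0 ≤ Λ φ) {φ ψ : X →ᵇ ℝ}
    (h : φ ≤ ψ) : Λ φ ≤ Λ ψ := by
  have := hΛ (ψ - φ) (sub_nonneg.2 h)
  rw [map_sub] at this
  linarith

/-- A Urysohn function `χ` for the closures splits any competitor `φ` for `C` into `(1 - χ) * φ` and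
`χ * φ`, competitors for the two pieces. -/
theorem premeasure_inter_add_inter_le {Λ : (X →ᵇ ℝ) →ₗ[ℝ] ℝ} (hΛ : ∀ φ, 0 ≤ φ → 0 ≤ Λ φ)
    {A B : Set X} (hAB : Metric.AreSeparated A B) (C : Set X) :
    premeasure Λ (C ∩ A) + premeasure Λ (C ∩ B) ≤ premeasure Λ C := by
  obtain ⟨r, hr, h⟩ := hAB
  have hd : Disjoint (closure A) (closure B) := by
    rw [Set.disjoint_left]
    intro x hxA hxB
    have hr2 : 0 < r / 2 := ENNReal.half_pos hr
    obtain ⟨a, ha, hxa⟩ := EMetric.mem_closure_iff.1 hxA (r / 2) hr2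
    obtain ⟨b, hb, hxb⟩ := EMetric.mem_closure_iff.1 hxB (r / 2) hr2
    have h1 : edist a b < r := by
      calc edist a b ≤ edist a x + edist x b := edist_triangle _ _ _
        _ < r / 2 + r / 2 := ENNReal.add_lt_add (by rwa [edist_comm]) hxb
        _ = r := ENNReal.add_halves r
    exact absurd (h a ha b hb) (not_le.2 h1)
  obtain ⟨χ, hχ0, hχ1, hχ⟩ := exists_bounded_zero_one_of_closed isClosed_closure isClosed_closure hd
  refine le_iInf₂ fun φ hφ => ?_
  have e : Λ φ = Λ ((1 - χ) * φ) + Λ (χ * φ) := by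
    rw [← map_add, sub_mul, one_mul, sub_add_cancel]
  have n1 : 0 ≤ (1 - χ) * φ := fun x => by
    simpa using mul_nonneg (sub_nonneg.2 (hχ x).2) (hφ.1 x)
  have n2 : 0 ≤ χ * φ := fun x => by
    simpa using mul_nonneg (hχ x).1 (hφ.1 x)
  rw [e, ENNReal.ofReal_add (hΛ _ n1) (hΛ _ n2)]
  refine add_le_add (premeasure_le Λ n1 fun x hx => ?_) (premeasure_le Λ n2 fun x hx => ?_)
  · simpa [hχ0 (subset_closure hx.2)] using hφ.2 x hx.1
  · simpa [hχ1 (subset_closure hx.2)] using hφ.2 x hx.1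

theorem outerMeasure_isMetric {Λ : (X →ᵇ ℝ) →ₗ[ℝ] ℝ} (hΛ : ∀ φ, 0 ≤ φ → 0 ≤ Λ φ) :
    (outerMeasure Λ).IsMetric := by
  intro A B hAB
  refine le_antisymm (measure_union_le A B) ?_
  rw [show outerMeasure Λ (A ∪ B) = _ from OuterMeasure.ofFunction_apply _ _ _]
  refine le_iInf₂ fun t ht => ?_
  have key : ∀ D ⊆ A ∪ B, outerMeasure Λ D ≤ ∑' n, premeasure Λ (t n ∩ D) := fun D hD =>
    calc outerMeasure Λ D ≤ outerMeasure Λ (⋃ n, t n ∩ D) := by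
          refine measure_mono fun x hx => ?_
          rw [← Set.iUnion_inter]
          exact ⟨ht (hD hx), hx⟩
      _ ≤ ∑' n, outerMeasure Λ (t n ∩ D) := measure_iUnion_le _
      _ ≤ _ := ENNReal.tsum_le_tsum fun n => OuterMeasure.ofFunction_le _
  refine (add_le_add (key A Set.subset_union_left) (key B Set.subset_union_right)).trans ?_
  rw [← ENNReal.tsum_add]
  exact ENNReal.tsum_le_tsum fun n => premeasure_inter_add_inter_le hΛ hAB _

/-- The only place where the representation needs σ-continuity: it rules out loss of mass under
countable covers. -/
theorem one_le_outerMeasure_univ {Λ : (X →ᵇ ℝ) →ₗ[ℝ] ℝ} (hΛ : ∀ φ, 0 ≤ φ → 0 ≤ Λ φ)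
    (h1 : Λ 1 = 1)
    (hσ : ∀ φ : ℕ → X →ᵇ ℝ, Antitone φ → (∀ x, Tendsto (fun n => φ n x) atTop (𝓝 0)) →
      Tendsto (fun n => Λ (φ n)) atTop (𝓝 0)) :
    1 ≤ outerMeasure Λ Set.univ := by
  rw [show outerMeasure Λ Set.univ = _ from OuterMeasure.ofFunction_apply _ _ _]
  refine le_iInf₂ fun t ht => ENNReal.le_of_forall_pos_le_add fun ε hε _ => ?_
  obtain ⟨ε', hε', hsum⟩ := ENNReal.exists_pos_sum_of_countable
    (ENNReal.coe_ne_zero.2 hε.ne') ℕ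
  have hex : ∀ n, ∃ φ : X →ᵇ ℝ, (0 ≤ φ ∧ ∀ x ∈ t n, 1 ≤ φ x) ∧
      ENNReal.ofReal (Λ φ) < premeasure Λ (t n) + ε' n := fun n => by
    have hlt : premeasure Λ (t n) < premeasure Λ (t n) + ε' n := by
      refine ENNReal.lt_add_right (ne_top_of_le_ne_top ENNReal.ofReal_ne_top
        (premeasure_le Λ (φ := 1) (fun _ => zero_le_one' ℝ) fun x _ => le_rfl)) ?_
      exact_mod_cast (hε' n).ne'
    obtain ⟨φ, hφ⟩ := iInf_lt_iff.1 hlt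
    obtain ⟨h, hφ⟩ := iInf_lt_iff.1 hφ
    exact ⟨φ, h, hφ⟩
  choose φ hφ hlt using hex
  -- The part of `1` not yet covered by the first `n` competitors; at each point it is eventually
  -- zero.
  let ψ : ℕ → X →ᵇ ℝ := fun n => (1 - ∑ i ∈ Finset.range n, φ i) ⊔ 0
  have hψa : Antitone ψ := by
    intro m n hmn
    refine sup_le_sup_right (sub_le_sub_left ?_ _) _
    exact Finset.sum_le_sum_of_subset_of_nonneg (Finset.range_mono hmn)
      fun i _ _ => (hφ i).1
  have hψ0 : ∀ x, Tendsto (fun n => ψ n x) atTop (𝓝 0) := by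
    intro x
    obtain ⟨i, hi⟩ := Set.mem_iUnion.1 (ht (Set.mem_univ x))
    refine tendsto_const_nhds.congr' ?_
    filter_upwards [eventually_gt_atTop i] with n hn
    have : 1 ≤ ∑ j ∈ Finset.range n, φ j x :=
      ((hφ i).2 x hi).trans (Finset.single_le_sum (f := fun j => φ j x)
        (fun j _ => (hφ j).1 x) (Finset.mem_range.2 hn))
    simp [ψ, this]
  have hle : ∀ n, 1 ≤ ENNReal.ofReal (Λ (ψ n)) + ∑' i, ENNReal.ofReal (Λ (φ i)) := by
    intro n
    have h : (1 : X →ᵇ ℝ) ≤ ψ n + ∑ i ∈ Finset.range n, φ i :=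
      sub_le_iff_le_add.1 le_sup_left
    have h' := map_mono hΛ h
    rw [h1, map_add, map_sum] at h'
    calc (1 : ℝ≥0∞) = ENNReal.ofReal 1 := by simp
      _ ≤ ENNReal.ofReal (Λ (ψ n) + ∑ i ∈ Finset.range n, Λ (φ i)) := ENNReal.ofReal_le_ofReal h'
      _ = ENNReal.ofReal (Λ (ψ n)) + ∑ i ∈ Finset.range n, ENNReal.ofReal (Λ (φ i)) := by
        rw [ENNReal.ofReal_add (hΛ _ le_sup_right)
          (Finset.sum_nonneg fun i _ => hΛ _ (hφ i).1),
          ENNReal.ofReal_sum_of_nonneg fun i _ => hΛ _ (hφ i).1]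
      _ ≤ _ := by gcongr; exact ENNReal.sum_le_tsum _
  have hlim : Tendsto (fun n => ENNReal.ofReal (Λ (ψ n)) + ∑' i, ENNReal.ofReal (Λ (φ i))) atTop
      (𝓝 (0 + ∑' i, ENNReal.ofReal (Λ (φ i)))) := by
    refine Tendsto.add ?_ tendsto_const_nhds
    simpa using ENNReal.tendsto_ofReal (hσ ψ hψa hψ0)
  have := ge_of_tendsto' hlim hle
  rw [zero_add] at this
  calc (1 : ℝ≥0∞) ≤ _ := this
    _ ≤ ∑' i, (premeasure Λ (t i) + ε' i) := ENNReal.tsum_le_tsum fun i => (hlt i).le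
    _ = ∑' i, premeasure Λ (t i) + ∑' i, (ε' i : ℝ≥0∞) := ENNReal.tsum_add
    _ ≤ _ := by gcongr

/-- The pointwise minimum of a bounded continuous function and a constant. -/
noncomputable def truncate (φ : X →ᵇ ℝ) (c : ℝ) : X →ᵇ ℝ := φ ⊓ BoundedContinuousFunction.const X c

@[simp] theorem truncate_apply (φ : X →ᵇ ℝ) (c : ℝ) (x : X) : truncate φ c x = min (φ x) c := rfl

variable [MeasurableSpace X] [BorelSpace X]

/-- Layer-cake comparison: the indicator of `{φ ≥ a + h}` lies below `1 / h` times the slice of `φ`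
between `a` and `a + h`. Each slice of the integral is thus paid for by the slice of `Λ` one level
lower, and this shift costs a single extra `h`. -/
theorem integral_truncate_le {Λ : (X →ᵇ ℝ) →ₗ[ℝ] ℝ} (hΛ : ∀ φ, 0 ≤ φ → 0 ≤ Λ φ)
    (ν : Measure X) [IsProbabilityMeasure ν] (hν : ∀ (A : Set X) (φ : X →ᵇ ℝ),
      MeasurableSet A → 0 ≤ φ → (∀ x ∈ A, 1 ≤ φ x) → ν A ≤ ENNReal.ofReal (Λ φ))
    {φ : X →ᵇ ℝ} {h : ℝ} (hh : 0 < h) (k : ℕ) :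
    ∫ x, truncate φ ((k + 1) * h) x ∂ν ≤ h + Λ (truncate φ (k * h)) - Λ (truncate φ 0) := by
  induction k with
  | zero =>
    have : ∫ x, truncate φ ((((0 : ℕ) : ℝ) + 1) * h) x ∂ν ≤ ∫ _, h ∂ν :=
      integral_mono (BoundedContinuousFunction.integrable ν _) (integrable_const _)
        fun x => by simp
    simpa using this
  | succ k ih =>
    set a : ℝ := k * h
    have e1 : ((k + 1 : ℕ) : ℝ) * h = a + h := by push_cast; ring
    have e2 : (((k + 1 : ℕ) : ℝ) + 1) * h = a + h + h := by push_cast; ring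
    have e3 : ((k : ℝ) + 1) * h = a + h := by ring
    rw [e1, e2]
    rw [e3] at ih
    set A : Set X := {x | a + h ≤ φ x}
    have hA : MeasurableSet A := measurableSet_le measurable_const φ.continuous.measurable
    have b1 : ∫ x, truncate φ (a + h + h) x ∂ν
        ≤ ∫ x, (truncate φ (a + h) x + A.indicator (fun _ => h) x) ∂ν := by
      refine integral_mono (BoundedContinuousFunction.integrable ν _)
        ((BoundedContinuousFunction.integrable ν _).add ((integrable_const h).indicator hA))
        fun x => ?_
      by_cases hx : x ∈ A
      · have hx' : a + h ≤ φ x := hx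
        simp [hx, hx']
      · have hx' : φ x < a + h := not_le.1 hx
        simp [hx, hx'.le]
    rw [integral_add (BoundedContinuousFunction.integrable ν _)
      ((integrable_const h).indicator hA), integral_indicator_const h hA] at b1
    have hle : truncate φ a ≤ truncate φ (a + h) := fun x => by
      exact min_le_min_left (φ x) (by linarith : a ≤ a + h)
    have b2 := hν A (h⁻¹ • (truncate φ (a + h) - truncate φ a)) hA
      (fun x => mul_nonneg (inv_nonneg.2 hh.le) (sub_nonneg.2 (hle x))) (fun x hx => by
        have hx' : a + h ≤ φ x := hx
        have hx2 : a ≤ φ x := by linarith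
        simp [hx', hx2, hh.ne'])
    rw [map_smul, map_sub, smul_eq_mul] at b2
    have b3 : ν.real A ≤ h⁻¹ * (Λ (truncate φ (a + h)) - Λ (truncate φ a)) :=
      ENNReal.toReal_le_of_le_ofReal
        (mul_nonneg (inv_nonneg.2 hh.le) (sub_nonneg.2 (map_mono hΛ hle))) b2
    have b4 : ν.real A * h ≤ Λ (truncate φ (a + h)) - Λ (truncate φ a) := by
      rw [inv_mul_eq_div, le_div_iff₀ hh] at b3
      exact b3
    rw [smul_eq_mul] at b1
    linarith

theorem integral_le_of_nonneg {Λ : (X →ᵇ ℝ) →ₗ[ℝ] ℝ} (hΛ : ∀ φ, 0 ≤ φ → 0 ≤ Λ φ)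
    (ν : Measure X) [IsProbabilityMeasure ν] (hν : ∀ (A : Set X) (φ : X →ᵇ ℝ),
      MeasurableSet A → 0 ≤ φ → (∀ x ∈ A, 1 ≤ φ x) → ν A ≤ ENNReal.ofReal (Λ φ))
    {φ : X →ᵇ ℝ} (hφ : 0 ≤ φ) : ∫ x, φ x ∂ν ≤ Λ φ := by
  refine le_of_forall_pos_le_add fun h hh => ?_
  -- For this `k` both upper truncations leave `φ` unchanged.
  obtain ⟨k, hk⟩ := exists_nat_ge (‖φ‖ / h)
  rw [div_le_iff₀ hh] at hk
  have hb : ∀ x, φ x ≤ k * h := fun x =>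
    ((le_abs_self _).trans (φ.norm_coe_le_norm x)).trans hk
  have t1 : truncate φ (k * h) = φ := by
    ext x; simpa using hb x
  have t2 : truncate φ ((k + 1) * h) = φ := by
    ext x
    have := hb x
    simp only [truncate_apply, inf_eq_left]
    linarith
  have t3 : truncate φ 0 = 0 := by
    ext x; simpa using hφ x
  have := integral_truncate_le hΛ ν hν (φ := φ) hh k
  rw [t1, t2, t3, map_zero] at this
  linarith

/-- **Daniell--Alexandrov representation**: a positive normalized functional on the bounded
continuous functions of a metric space that is continuous along sequences decreasing pointwise to
zero is integration against a Borel probability measure. -/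
theorem exists_probabilityMeasure {Λ : (X →ᵇ ℝ) →ₗ[ℝ] ℝ} (hΛ : ∀ φ, 0 ≤ φ → 0 ≤ Λ φ)
    (h1 : Λ 1 = 1)
    (hσ : ∀ φ : ℕ → X →ᵇ ℝ, Antitone φ → (∀ x, Tendsto (fun n => φ n x) atTop (𝓝 0)) →
      Tendsto (fun n => Λ (φ n)) atTop (𝓝 0)) :
    ∃ ν : ProbabilityMeasure X, ∀ φ : X →ᵇ ℝ, ∫ x, φ x ∂(ν : Measure X) = Λ φ := by
  have hc : ‹MeasurableSpace X› ≤ (outerMeasure Λ).caratheodory :=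
    (BorelSpace.measurable_eq (α := X)).le.trans (outerMeasure_isMetric hΛ).borel_le_caratheodory
  let ν : Measure X := (outerMeasure Λ).toMeasure hc
  have hν : ∀ (A : Set X) (φ : X →ᵇ ℝ), MeasurableSet A → 0 ≤ φ → (∀ x ∈ A, 1 ≤ φ x) →
      ν A ≤ ENNReal.ofReal (Λ φ) := fun A φ hA h0 h => by
    rw [toMeasure_apply _ _ hA]
    exact outerMeasure_le Λ h0 h
  have hp : IsProbabilityMeasure ν := by
    refine ⟨le_antisymm ?_ ?_⟩
    · simpa [h1] using hν Set.univ 1 MeasurableSet.univ (fun _ => zero_le_one' ℝ) fun x _ => le_rfl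
    · rw [toMeasure_apply _ _ MeasurableSet.univ]
      exact one_le_outerMeasure_univ hΛ h1 hσ
  refine ⟨⟨ν, hp⟩, fun φ => ?_⟩
  have hc : ∀ c : ℝ, Λ (BoundedContinuousFunction.const X c) = c := fun c => by
    have : BoundedContinuousFunction.const X c = c • (1 : X →ᵇ ℝ) := by ext x; simp
    rw [this, map_smul, h1, smul_eq_mul, mul_one]
  have up : ∀ φ : X →ᵇ ℝ, ∫ x, φ x ∂ν ≤ Λ φ := fun φ => by
    -- Adding the constant `‖φ‖` reduces to the nonnegative case.
    have h := integral_le_of_nonneg hΛ ν hν (φ := φ + BoundedContinuousFunction.const X ‖φ‖)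
      fun x => by
        have := neg_abs_le (φ x)
        have := φ.norm_coe_le_norm x
        rw [Real.norm_eq_abs] at this
        change 0 ≤ φ x + ‖φ‖
        linarith
    rw [map_add, hc] at h
    simp only [BoundedContinuousFunction.add_apply, BoundedContinuousFunction.const_apply] at h
    rw [integral_add (BoundedContinuousFunction.integrable ν _) (integrable_const _)] at h
    simpa using h
  refine le_antisymm (up φ) ?_
  have h := up (-φ)
  simp only [map_neg, BoundedContinuousFunction.neg_apply, integral_neg] at h
  exact neg_le_neg_iff.1 h

end DaniellRepresentation

/-! ### Continuity of subsums of a telescoping series. -/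

section Telescoping

variable {X : Type*} [TopologicalSpace X]

/-- If `χ n` decreases pointwise to zero, every subsum of the increments `χ i - χ (i + 1)` is a
bounded continuous function. -/
theorem exists_hasSum_subsum_increments {χ : ℕ → X →ᵇ ℝ} (hχ : Antitone χ)
    (hlim : ∀ x, Tendsto (fun n => χ n x) atTop (𝓝 0)) (b : ℕ → Bool) :
    ∃ F : X →ᵇ ℝ, ∀ x, HasSum (fun i => if b i then (χ i - χ (i + 1)) x else 0) (F x) := by
  have hanti : ∀ x, Antitone fun n => χ n x := fun x m n h => hχ h x
  have hχ0 : ∀ n x, 0 ≤ χ n x := fun n x => (hanti x).le_of_tendsto (hlim x) n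
  let g : X → ℕ → ℝ := fun x i => if b i then (χ i - χ (i + 1)) x else 0
  have hg0 : ∀ x i, 0 ≤ g x i := fun x i => by
    by_cases h : b i
    · simpa [g, h] using hanti x i.le_succ
    · simp [g, h]
  have hg1 : ∀ x i, g x i ≤ χ i x - χ (i + 1) x := fun x i => by
    by_cases h : b i
    · simp [g, h]
    · simpa [g, h] using hanti x i.le_succ
  have hpart : ∀ x K n, ∑ i ∈ Finset.range n, g x (i + K) ≤ χ K x := fun x K n => by
    calc ∑ i ∈ Finset.range n, g x (i + K)
        ≤ ∑ i ∈ Finset.range n, (χ (i + K) x - χ (i + 1 + K) x) :=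
          Finset.sum_le_sum fun i _ => by
            have := hg1 x (i + K)
            rwa [add_right_comm] at this
      _ = χ (0 + K) x - χ (n + K) x := Finset.sum_range_sub' (fun i => χ (i + K) x) n
      _ ≤ χ K x := by rw [zero_add]; linarith [hχ0 (n + K) x]
  have hsum : ∀ x, Summable (g x) := fun x =>
    summable_of_sum_range_le (hg0 x) (fun n => hpart x 0 n)
  have htail : ∀ x K, dist (∑' i, g x i) (∑ i ∈ Finset.range K, g x i) ≤ χ K x := fun x K => by
    rw [← (hsum x).sum_add_tsum_nat_add K, Real.dist_eq, add_sub_cancel_left,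
      abs_of_nonneg (tsum_nonneg fun i => hg0 x _)]
    exact Real.tsum_le_of_sum_range_le (fun i => hg0 x _) (hpart x K)
  have hcont : Continuous fun x => ∑' i, g x i := by
    have hu : TendstoLocallyUniformly (fun K x => ∑ i ∈ Finset.range K, g x i)
        (fun x => ∑' i, g x i) atTop := by
      rw [Metric.tendstoLocallyUniformly_iff]
      intro ε hε x
      -- As in Dini's theorem: `χ K < ε` persists near `x`, and there it bounds every later tail.
      obtain ⟨K, hK⟩ := ((hlim x).eventually_lt_const hε).exists
      refine ⟨{y | χ K y < ε}, (χ K).continuous.continuousAt.eventually_lt_const hK, ?_⟩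
      filter_upwards [eventually_ge_atTop K] with n hn y hy
      exact (htail y n).trans_lt ((hanti y hn).trans_lt hy)
    refine hu.continuous (Frequently.of_forall fun K => continuous_finsetSum _ fun i _ => ?_)
    by_cases h : b i
    · simpa only [g, h, if_true] using (χ i - χ (i + 1)).continuous
    · simpa [g, h] using continuous_const
  refine ⟨BoundedContinuousFunction.ofNormedAddCommGroup _ hcont ‖χ 0‖ fun x => ?_,
    fun x => (hsum x).hasSum⟩
  have := htail x 0
  simp only [Finset.range_zero, Finset.sum_empty, dist_zero_right] at this
  exact this.trans ((le_abs_self _).trans ((χ 0).norm_coe_le_norm x))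

end Telescoping

/-! ### Feller semigroups on bounded continuous functions and measurability in time. -/

section Feller

variable {X : Type*} [MetricSpace X] [MeasurableSpace X] [BorelSpace X]
  {P : ℝ≥0 → Bb X →ₗ[ℝ] Bb X} {Pstar : ℝ≥0 → ProbabilityMeasure X → ProbabilityMeasure X}

/-- A bounded continuous function as a bounded Borel function. -/
def BoundedContinuousFunction.toBb (φ : X →ᵇ ℝ) : Bb X :=
  ⟨φ, φ.continuous.measurable, ‖φ‖, φ.norm_coe_le_norm⟩

/-- The Dirac mass as a probability measure. -/
noncomputable def diracProb (x : X) : ProbabilityMeasure X := ⟨Measure.dirac x, inferInstance⟩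

theorem abs_integral_le_norm (φ : X →ᵇ ℝ) (μ : ProbabilityMeasure X) :
    |∫ x, φ x ∂(μ : Measure X)| ≤ ‖φ‖ :=
  φ.norm_integral_le_norm (μ : Measure X)

namespace IsFellerSemigroup

theorem apply_eq_integral (hP : IsFellerSemigroup P Pstar) (t : ℝ≥0) (φ : Bb X) (x : X) :
    P t φ x = ∫ y, φ y ∂(Pstar t (diracProb x) : Measure X) := by
  rw [← hP.dual.duality]
  exact (integral_dirac (fun y => P t φ y) x).symm

/-- The action of a Feller semigroup on bounded continuous functions. -/
noncomputable def toBCF (hP : IsFellerSemigroup P Pstar) (t : ℝ≥0) (φ : X →ᵇ ℝ) : X →ᵇ ℝ :=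
  BoundedContinuousFunction.ofNormedAddCommGroup (P t φ.toBb) (hP.feller t φ.toBb φ.continuous) ‖φ‖
    fun x => by
      rw [hP.apply_eq_integral]
      exact abs_integral_le_norm φ _

theorem toBCF_apply (hP : IsFellerSemigroup P Pstar) (t : ℝ≥0) (φ : X →ᵇ ℝ) (x : X) :
    hP.toBCF t φ x = ∫ y, φ y ∂(Pstar t (diracProb x) : Measure X) :=
  hP.apply_eq_integral t φ.toBb x

theorem integral_toBCF (hP : IsFellerSemigroup P Pstar) (t : ℝ≥0) (φ : X →ᵇ ℝ)
    (μ : ProbabilityMeasure X) :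
    ∫ x, hP.toBCF t φ x ∂(μ : Measure X) = ∫ x, φ x ∂(Pstar t μ : Measure X) :=
  hP.dual.duality t φ.toBb μ

theorem integral_add (hP : IsFellerSemigroup P Pstar) (s t : ℝ≥0) (φ : X →ᵇ ℝ)
    (μ : ProbabilityMeasure X) :
    ∫ x, φ x ∂(Pstar (s + t) μ : Measure X) = ∫ x, hP.toBCF t φ x ∂(Pstar s μ : Measure X) := by
  rw [add_comm, hP.dual.add, hP.integral_toBCF]

theorem tendsto_toBCF (hP : IsFellerSemigroup P Pstar) (φ : X →ᵇ ℝ) (x : X) :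
    Tendsto (fun t => hP.toBCF t φ x) (𝓝[>] 0) (𝓝 (φ x)) :=
  hP.stochCont φ.toBb φ.continuous x

theorem norm_toBCF_le (hP : IsFellerSemigroup P Pstar) (t : ℝ≥0) (φ : X →ᵇ ℝ) (x : X) :
    ‖hP.toBCF t φ x‖ ≤ ‖φ‖ := by
  rw [toBCF_apply]
  exact abs_integral_le_norm φ _

theorem tendsto_integral_add (hP : IsFellerSemigroup P Pstar) (φ : X →ᵇ ℝ)
    (μ : ProbabilityMeasure X) (s : ℝ≥0) :
    Tendsto (fun h => ∫ x, φ x ∂(Pstar (h + s) μ : Measure X)) (𝓝[>] 0)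
      (𝓝 (∫ x, φ x ∂(Pstar s μ : Measure X))) := by
  simp_rw [hP.integral_add _ s, ← hP.integral_toBCF]
  refine tendsto_integral_filter_of_dominated_convergence (fun _ => ‖hP.toBCF s φ‖)
    (Eventually.of_forall fun h => (hP.toBCF h _).continuous.aestronglyMeasurable)
    (Eventually.of_forall fun h => Eventually.of_forall fun x => hP.norm_toBCF_le h _ x)
    (integrable_const _) (Eventually.of_forall fun x => hP.tendsto_toBCF _ x)

theorem measurable_integral (hP : IsFellerSemigroup P Pstar) (φ : X →ᵇ ℝ)
    (μ : ProbabilityMeasure X) :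
    Measurable fun s : ℝ≥0 => ∫ x, φ x ∂(Pstar s μ : Measure X) := by
  set G : ℝ≥0 → ℝ := fun s => ∫ x, φ x ∂(Pstar s μ : Measure X)
  -- Only right continuity in time is available, so `s` is approximated by grid points strictly to
  -- its right; the `+ 1` after the floor ensures strictness.
  let u : ℕ → ℝ≥0 → ℝ≥0 := fun n s => ((⌊((n : ℝ≥0) + 1) * s⌋₊ : ℝ≥0) + 1) / ((n : ℝ≥0) + 1)
  have hlt : ∀ n s, s < u n s := fun n s => by
    rw [lt_div_iff₀ (by positivity), mul_comm]
    exact Nat.lt_floor_add_one _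
  have hle : ∀ n s, u n s ≤ s + 1 / ((n : ℝ≥0) + 1) := fun n s => by
    rw [div_le_iff₀ (by positivity), add_mul s, one_div, inv_mul_cancel₀ (by positivity), mul_comm s]
    gcongr
    exact Nat.floor_le (zero_le)
  refine measurable_of_tendsto_metrizable (f := fun n s => G (u n s)) (fun n => ?_)
    (tendsto_pi_nhds.2 fun s => ?_)
  · exact (Measurable.of_discrete (f := fun k : ℕ => G (((k : ℝ≥0) + 1) / ((n : ℝ≥0) + 1)))).comp
      (Nat.measurable_floor.comp (measurable_id.const_mul _))
  · have h0 : Tendsto (fun n => u n s - s) atTop (𝓝[>] 0) := by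
      refine tendsto_nhdsWithin_iff.2 ⟨?_, Eventually.of_forall fun n => tsub_pos_of_lt (hlt n s)⟩
      refine tendsto_of_tendsto_of_tendsto_of_le_of_le tendsto_const_nhds
        (tendsto_one_div_add_atTop_nhds_zero_nat (𝕜 := ℝ≥0)) (fun n => zero_le) fun n => ?_
      exact tsub_le_iff_left.2 (hle n s)
    refine ((hP.tendsto_integral_add φ μ s).comp h0).congr fun n => ?_
    simp only [Function.comp_apply, G]
    rw [tsub_add_cancel_of_le (hlt n s).le]

/-- The expectation of `φ` at time `s` of the process started from `μ`, with real time. -/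
noncomputable def orbit (Pstar : ℝ≥0 → ProbabilityMeasure X → ProbabilityMeasure X)
    (μ : ProbabilityMeasure X) (φ : X →ᵇ ℝ) (s : ℝ) : ℝ :=
  ∫ x, φ x ∂(Pstar s.toNNReal μ : Measure X)

theorem norm_orbit_le (μ : ProbabilityMeasure X) (φ : X →ᵇ ℝ) (s : ℝ) :
    ‖orbit Pstar μ φ s‖ ≤ ‖φ‖ := abs_integral_le_norm φ _

omit [BorelSpace X] in
theorem orbit_nonneg (μ : ProbabilityMeasure X) {φ : X →ᵇ ℝ} (h : 0 ≤ φ) (s : ℝ) :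
    0 ≤ orbit Pstar μ φ s := integral_nonneg fun x => h x

theorem orbit_add_fun (μ : ProbabilityMeasure X) (φ ψ : X →ᵇ ℝ) (s : ℝ) :
    orbit Pstar μ (φ + ψ) s = orbit Pstar μ φ s + orbit Pstar μ ψ s :=
  MeasureTheory.integral_add (BoundedContinuousFunction.integrable _ _)
    (BoundedContinuousFunction.integrable _ _)

omit [BorelSpace X] in
theorem orbit_smul (μ : ProbabilityMeasure X) (c : ℝ) (φ : X →ᵇ ℝ) (s : ℝ) :
    orbit Pstar μ (c • φ) s = c * orbit Pstar μ φ s :=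
  integral_const_mul c _

theorem intervalIntegrable_orbit (hP : IsFellerSemigroup P Pstar) (μ : ProbabilityMeasure X)
    (φ : X →ᵇ ℝ) (a b : ℝ) : IntervalIntegrable (orbit Pstar μ φ) volume a b := by
  refine (intervalIntegrable_const (c := ‖φ‖)).mono_fun ?_ (Eventually.of_forall fun s => ?_)
  · exact ((hP.measurable_integral φ μ).comp measurable_real_toNNReal).aestronglyMeasurable
  · simpa using norm_orbit_le μ φ s

theorem orbit_add (hP : IsFellerSemigroup P Pstar) (μ : ProbabilityMeasure X) (φ : X →ᵇ ℝ)
    {s : ℝ} (hs : 0 ≤ s) (r : ℝ≥0) :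
    orbit Pstar μ φ (s + r) = orbit Pstar μ (hP.toBCF r φ) s := by
  rw [orbit, Real.toNNReal_add hs r.coe_nonneg, Real.toNNReal_coe, hP.integral_add]
  rfl

theorem integral_orbit_toBCF (hP : IsFellerSemigroup P Pstar) (μ : ProbabilityMeasure X)
    (φ : X →ᵇ ℝ) {t : ℝ} (ht : 0 ≤ t) (r : ℝ≥0) :
    ∫ s in (0 : ℝ)..t, orbit Pstar μ (hP.toBCF r φ) s
      = ∫ s in (r : ℝ)..(t + r), orbit Pstar μ φ s := by
  have h := intervalIntegral.integral_comp_add_right (a := 0) (b := t) (orbit Pstar μ φ) (r : ℝ)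
  rw [zero_add] at h
  rw [← h]
  refine intervalIntegral.integral_congr fun s hs => ?_
  rw [Set.uIcc_of_le ht] at hs
  exact (hP.orbit_add μ φ hs.1 r).symm

theorem hasSum_toBCF (hP : IsFellerSemigroup P Pstar) {f : ℕ → X →ᵇ ℝ} (hf : ∀ i, 0 ≤ f i)
    {F : (ℕ → Bool) → X →ᵇ ℝ}
    (hF : ∀ b x, HasSum (fun i => if b i then f i x else 0) (F b x)) (b : ℕ → Bool) (t : ℝ≥0)
    (y : X) :
    HasSum (fun i => if b i then hP.toBCF t (f i) y else 0) (hP.toBCF t (F b) y) := by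
  have htrue : ∀ x, HasSum (fun i => f i x) (F (fun _ => true) x) := fun x => by
    simpa using hF (fun _ => true) x
  have h := hasSum_integral_of_dominated_convergence
    (μ := (Pstar t (diracProb y) : Measure X)) (F := fun i x => if b i then f i x else 0)
    (f := F b) (fun i x => f i x) (fun i => ?_) (fun i => Eventually.of_forall fun x => ?_)
    (Eventually.of_forall fun x => (htrue x).summable) ?_ (Eventually.of_forall fun x => hF b x)
  · rw [toBCF_apply]
    refine h.congr_fun fun i => ?_
    by_cases hi : b i <;> simp [hi, toBCF_apply]
  · by_cases hi : b i
    · simpa [hi] using (f i).continuous.aestronglyMeasurable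
    · simpa [hi] using aestronglyMeasurable_const
  · by_cases hi : b i
    · simpa [hi] using (abs_of_nonneg (hf i x)).le
    · simpa [hi] using hf i x
  · simp_rw [fun x => (htrue x).tsum_eq]
    exact BoundedContinuousFunction.integrable _ _

/-! ### Equicontinuity at `z`, uniform over a family of increments. -/

theorem eventually_abs_toBCF_sub_le (hP : IsFellerSemigroup P Pstar) {z : X}
    (hz : ∀ φ : Bb X, Continuous (φ : X → ℝ) →
      EquicontinuousAt (fun (t : ℝ≥0) (x : X) => P t φ x) z)
    (φ : X →ᵇ ℝ) {ε : ℝ} (hε : 0 < ε) :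
    ∀ᶠ y in 𝓝 z, ∀ t, |hP.toBCF t φ y - hP.toBCF t φ z| ≤ ε := by
  have := Metric.equicontinuousAt_iff_right.1 (hz φ.toBb φ.continuous) ε hε
  filter_upwards [this] with y hy t
  have h := (hy t).le
  rw [dist_comm] at h
  exact h

/-- A Schur-type property: if all subsums of `f` are bounded continuous functions, then the family
`P_t (f i)` is equicontinuous at `z` uniformly in `t` and `i`. -/
theorem eventually_forall_abs_toBCF_sub_le (hP : IsFellerSemigroup P Pstar) {z : X}
    (hz : ∀ φ : Bb X, Continuous (φ : X → ℝ) →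
      EquicontinuousAt (fun (t : ℝ≥0) (x : X) => P t φ x) z)
    {f : ℕ → X →ᵇ ℝ} (hf : ∀ i, 0 ≤ f i) {F : (ℕ → Bool) → X →ᵇ ℝ}
    (hF : ∀ b x, HasSum (fun i => if b i then f i x else 0) (F b x)) {ε : ℝ} (hε : 0 < ε) :
    ∀ᶠ y in 𝓝 z, ∀ i t, |hP.toBCF t (f i) y - hP.toBCF t (f i) z| ≤ ε := by
  have hcont : ∀ t y, Continuous fun b => hP.toBCF t (F b) y := fun t y => by
    have hs : Summable fun i => hP.toBCF t (f i) y := by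
      simpa using (hP.hasSum_toBCF hf hF (fun _ => true) t y).summable
    have h0 : ∀ i, 0 ≤ hP.toBCF t (f i) y := fun i => by
      rw [toBCF_apply]
      exact integral_nonneg (hf i)
    simp_rw [fun b => ((hP.hasSum_toBCF hf hF b t y).tsum_eq).symm]
    refine continuous_tsum (fun i => ?_) hs fun i b => ?_
    · exact (continuous_of_discreteTopology
        (f := fun c : Bool => if c then hP.toBCF t (f i) y else 0)).comp (continuous_apply i)
    · by_cases hi : b i
      · simpa [hi] using (abs_of_nonneg (h0 i)).le
      · simpa [hi] using h0 i
  -- Baire category on `{0,1}^ℕ`: these closed sets cover the space by equicontinuity of each single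
  -- `F b`, so one of them has an interior point.
  let E : ℕ → Set (ℕ → Bool) := fun m =>
    {b | ∀ y ∈ Metric.ball z (1 / ((m : ℝ) + 1)), ∀ t,
      |hP.toBCF t (F b) y - hP.toBCF t (F b) z| ≤ ε / 2}
  have hE : ∀ m, IsClosed (E m) := fun m => by
    simp only [E, Set.ofPred_forall]
    exact isClosed_iInter fun y => isClosed_iInter fun _ => isClosed_iInter fun t =>
      isClosed_le ((hcont t y).sub (hcont t z)).abs continuous_const
  have hU : ⋃ m, E m = Set.univ := by
    refine Set.eq_univ_of_forall fun b => Set.mem_iUnion.2 ?_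
    obtain ⟨r, hr, h⟩ := Metric.eventually_nhds_iff_ball.1
      (hP.eventually_abs_toBCF_sub_le hz (F b) (half_pos hε))
    obtain ⟨m, hm⟩ := exists_nat_one_div_lt hr
    exact ⟨m, fun y hy => h y (Metric.ball_subset_ball hm.le hy)⟩
  obtain ⟨m, b, hb⟩ := nonempty_interior_of_iUnion_of_closed hE hU
  -- Changing a far coordinate of `b` stays in the interior; the difference between the two values
  -- at coordinate `i` isolates `f i`, with error `ε / 2 + ε / 2`.
  have hup : ∀ c : Bool, ∀ᶠ i in atTop, Function.update b i c ∈ E m := fun c => by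
    have ht : Tendsto (fun i => Function.update b i c) atTop (𝓝 b) := by
      refine tendsto_pi_nhds.2 fun j => tendsto_const_nhds.congr' ?_
      filter_upwards [eventually_gt_atTop j] with i hi
      rw [Function.update_of_ne hi.ne]
    exact ht.eventually (mem_interior_iff_mem_nhds.1 hb)
  obtain ⟨N, hN⟩ := eventually_atTop.1 ((hup true).and (hup false))
  have hdiff : ∀ i t y, hP.toBCF t (F (Function.update b i true)) y
      - hP.toBCF t (F (Function.update b i false)) y = hP.toBCF t (f i) y := fun i t y => by
    have h1 := (hP.hasSum_toBCF hf hF (Function.update b i true) t y).sub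
      (hP.hasSum_toBCF hf hF (Function.update b i false) t y)
    have h2 := hasSum_single (f := fun j => (if Function.update b i true j then
        hP.toBCF t (f j) y else 0) - if Function.update b i false j then
        hP.toBCF t (f j) y else 0) i fun j hj => by simp [Function.update_of_ne hj]
    simpa using h1.unique h2
  have hsmall : ∀ᶠ y in 𝓝 z, ∀ i ∈ Finset.range N, ∀ t,
      |hP.toBCF t (f i) y - hP.toBCF t (f i) z| ≤ ε :=
    (Finset.eventually_all _).2 fun i _ => hP.eventually_abs_toBCF_sub_le hz (f i) hε
  filter_upwards [hsmall, Metric.ball_mem_nhds z (Nat.one_div_pos_of_nat (n := m))] with y hy hyb i t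
  rcases lt_or_ge i N with hi | hi
  · exact hy i (Finset.mem_range.2 hi) t
  · have h1 := abs_le.1 ((hN i hi).1 y hyb t)
    have h2 := abs_le.1 ((hN i hi).2 y hyb t)
    rw [← hdiff i t y, ← hdiff i t z, abs_le]
    constructor <;> linarith [h1.1, h1.2, h2.1, h2.2]

/-! ### Recurrence near `z` and uniform smoothness of the orbit of `δ_z`. -/

/-- Mass recurring near `z` cannot be sent into infinitely many functions with bounded sum. -/
theorem not_forall_ball_le_toBCF (hP : IsFellerSemigroup P Pstar) {z : X}
    {μ : ProbabilityMeasure X} {r : ℝ}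
    (hμ : 0 < liminf (fun t : ℝ => (1 / t) * ∫ s in (0 : ℝ)..t,
          (Pstar s.toNNReal μ : Measure X).real (Metric.ball z r)) atTop)
    {f : ℕ → X →ᵇ ℝ} (hf : ∀ i, 0 ≤ f i) {C : ℝ}
    (hC : ∀ N x, ∑ i ∈ Finset.range N, f i x ≤ C) (τ : ℕ → ℝ≥0) {c : ℝ} (hc : 0 < c) :
    ¬ ∀ i, ∀ y ∈ Metric.ball z r, c ≤ hP.toBCF (τ i) (f i) y := by
  intro hlow
  set m : ℝ → ℝ := fun s => (Pstar s.toNNReal μ : Measure X).real (Metric.ball z r)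
  obtain ⟨γ, hγ, hγl⟩ := exists_between hμ
  have hbdd : IsBoundedUnder (· ≥ ·) atTop fun t : ℝ => (1 / t) * ∫ s in (0 : ℝ)..t, m s := by
    refine isBoundedUnder_of_eventually_ge (a := 0) ?_
    filter_upwards [eventually_ge_atTop (0 : ℝ)] with t ht
    exact mul_nonneg (by positivity)
      (intervalIntegral.integral_nonneg ht fun s _ => measureReal_nonneg)
  have hev := eventually_lt_of_lt_liminf hγl hbdd
  obtain ⟨N, hN⟩ := exists_nat_gt (2 * C / (c * γ))
  rw [div_lt_iff₀ (by positivity)] at hN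
  -- Taking `t` above all `τ i` with `i < N` keeps each window `[τ i, t + τ i]` inside `[0, 2 * t]`.
  -- Summing over `i` then gives `N * c * γ * t ≤ 2 * t * C`, against the choice of `N`.
  obtain ⟨t, ht, ht1, htτ⟩ := (hev.and ((eventually_ge_atTop (1 : ℝ)).and
    (eventually_ge_atTop ((∑ i ∈ Finset.range N, τ i : ℝ≥0) : ℝ)))).exists
  have ht0 : 0 < t := by linarith
  rw [one_div, inv_mul_eq_div, lt_div_iff₀ ht0] at ht
  have hone : ∀ i ∈ Finset.range N,
      c * ∫ s in (0 : ℝ)..t, m s ≤ ∫ s in (0 : ℝ)..(2 * t), orbit Pstar μ (f i) s := by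
    intro i hi
    have hτ : (τ i : ℝ) ≤ t := by
      refine le_trans ?_ htτ
      exact_mod_cast Finset.single_le_sum (f := τ) (fun _ _ => zero_le) hi
    have hle : c * ∫ s in (0 : ℝ)..t, m s
        ≤ ∫ s in (0 : ℝ)..t, orbit Pstar μ (hP.toBCF (τ i) (f i)) s := by
      rw [← intervalIntegral.integral_const_mul, intervalIntegral.integral_of_le ht0.le,
        intervalIntegral.integral_of_le ht0.le]
      refine integral_mono_of_nonneg
        (Eventually.of_forall fun s => mul_nonneg hc.le measureReal_nonneg)
        ((intervalIntegrable_iff_integrableOn_Ioc_of_le ht0.le).1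
          (hP.intervalIntegrable_orbit _ _ _ _))
        (Eventually.of_forall fun s => ?_)
      have hb : MeasurableSet (Metric.ball z r) := Metric.isOpen_ball.measurableSet
      calc c * m s = ∫ x, (Metric.ball z r).indicator (fun _ => c) x
            ∂(Pstar s.toNNReal μ : Measure X) := by
            rw [integral_indicator_const c hb, smul_eq_mul, mul_comm]
        _ ≤ _ := by
            refine integral_mono ((integrable_const c).indicator hb)
              (BoundedContinuousFunction.integrable _ _) fun x => ?_
            by_cases hx : x ∈ Metric.ball z r
            · simpa only [Set.indicator_of_mem hx] using hlow i x hx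
            · simp only [Set.indicator_of_notMem hx]
              rw [toBCF_apply]
              exact integral_nonneg (hf i)
    refine hle.trans ?_
    rw [hP.integral_orbit_toBCF μ (f i) ht0.le]
    exact intervalIntegral.integral_mono_interval (τ i).2 (by linarith) (by linarith)
      (Eventually.of_forall fun s => orbit_nonneg μ (hf i) s)
      (hP.intervalIntegrable_orbit _ _ _ _)
  have hsum := Finset.sum_le_sum hone
  rw [Finset.sum_const, Finset.card_range, nsmul_eq_mul,
    ← intervalIntegral.integral_finsetSum fun i _ => hP.intervalIntegrable_orbit _ _ _ _] at hsum
  have hint : IntervalIntegrable (fun s => ∑ i ∈ Finset.range N, orbit Pstar μ (f i) s) volume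
      0 (2 * t) := by
    have := IntervalIntegrable.sum (Finset.range N)
      fun i _ => hP.intervalIntegrable_orbit μ (f i) 0 (2 * t)
    rwa [Finset.sum_fn] at this
  have hup : ∫ s in (0 : ℝ)..(2 * t), ∑ i ∈ Finset.range N, orbit Pstar μ (f i) s
      ≤ ∫ _ in (0 : ℝ)..(2 * t), C := by
    refine intervalIntegral.integral_mono_on (by linarith)
      hint
      intervalIntegrable_const fun s _ => ?_
    simp only [orbit]
    rw [← integral_finsetSum _ fun i _ => BoundedContinuousFunction.integrable _ _]
    calc _ ≤ ∫ _, C ∂(Pstar s.toNNReal μ : Measure X) :=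
          integral_mono (integrable_finsetSum _ fun i _ =>
            BoundedContinuousFunction.integrable _ _) (integrable_const _) (hC N)
      _ = C := by simp
  rw [intervalIntegral.integral_const, smul_eq_mul, sub_zero] at hup
  have h1 : (N : ℝ) * (c * (γ * t)) ≤ 2 * t * C := by
    refine le_trans ?_ (hsum.trans hup)
    gcongr
  have h2 : (2 * C) * t < (N : ℝ) * (c * γ) * t := by gcongr
  linarith

/-- Uniform smoothness of the measures `P_t^* δ_z`. -/
theorem exists_forall_toBCF_lt (hP : IsFellerSemigroup P Pstar) {z : X}
    {μ : ProbabilityMeasure X}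
    (hμ : ∀ ε : ℝ, 0 < ε → 0 < liminf (fun t : ℝ => (1 / t) * ∫ s in (0 : ℝ)..t,
          (Pstar s.toNNReal μ : Measure X).real (Metric.ball z ε)) atTop)
    (hz : ∀ φ : Bb X, Continuous (φ : X → ℝ) →
      EquicontinuousAt (fun (t : ℝ≥0) (x : X) => P t φ x) z)
    {φ : ℕ → X →ᵇ ℝ} (hφ : Antitone φ) (hlim : ∀ x, Tendsto (fun n => φ n x) atTop (𝓝 0))
    {δ : ℝ} (hδ : 0 < δ) : ∃ n, ∀ t, hP.toBCF t (φ n) z < δ := by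
  by_contra! hcon
  choose t ht using hcon
  have hanti : ∀ x, Antitone fun n => φ n x := fun x m n h => hφ h x
  have hφ0 : ∀ n x, 0 ≤ φ n x := fun n x => (hanti x).le_of_tendsto (hlim x) n
  have hdec : ∀ s, Tendsto (fun n => hP.toBCF s (φ n) z) atTop (𝓝 0) := fun s => by
    simp_rw [toBCF_apply]
    have := tendsto_integral_of_dominated_convergence
      (μ := (Pstar s (diracProb z) : Measure X)) (F := fun n x => φ n x) (f := fun _ => (0 : ℝ))
      (fun x => φ 0 x) (fun n => (φ n).continuous.aestronglyMeasurable)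
      (BoundedContinuousFunction.integrable _ _)
      (fun n => Eventually.of_forall fun x => by
        rw [Real.norm_of_nonneg (hφ0 n x)]
        exact hanti x (Nat.zero_le n))
      (Eventually.of_forall hlim)
    simpa using this
  -- Gliding hump: at the fixed time `t n`, a later function has lost all but `δ / 2`, so the
  -- increment in between keeps at least `δ / 2` at `z`.
  have hnext : ∀ n, ∃ m, n < m ∧ hP.toBCF (t n) (φ m) z ≤ δ / 2 := fun n =>
    ((eventually_gt_atTop n).and
      ((hdec (t n)).eventually_le_const (half_pos hδ))).exists
  choose next hgt hnext using hnext
  let k : ℕ → ℕ := fun i => next^[i] 0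
  have hk1 : ∀ i, k (i + 1) = next (k i) := fun i => Function.iterate_succ_apply' next i 0
  have hk : StrictMono k := strictMono_nat_of_lt_succ fun i => by
    rw [hk1]
    exact hgt _
  let χ : ℕ → X →ᵇ ℝ := fun i => φ (k i)
  have hχ : Antitone χ := hφ.comp_monotone hk.monotone
  have hχlim : ∀ x, Tendsto (fun i => χ i x) atTop (𝓝 0) := fun x =>
    (hlim x).comp hk.tendsto_atTop
  choose F hF using exists_hasSum_subsum_increments hχ hχlim
  let f : ℕ → X →ᵇ ℝ := fun i => χ i - χ (i + 1)
  have hf : ∀ i, 0 ≤ f i := fun i => sub_nonneg.2 (hχ i.le_succ)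
  have hev := hP.eventually_forall_abs_toBCF_sub_le hz hf hF (ε := δ / 4) (by positivity)
  obtain ⟨r, hr, hball⟩ := Metric.eventually_nhds_iff_ball.1 hev
  refine hP.not_forall_ball_le_toBCF (hμ r hr) hf (C := ‖φ 0‖) (fun N x => ?_)
    (fun i => t (k i)) (c := δ / 4) (by positivity) fun i y hy => ?_
  · calc ∑ i ∈ Finset.range N, f i x = χ 0 x - χ N x := Finset.sum_range_sub' (fun i => χ i x) N
      _ ≤ φ 0 x := by
        have := hφ0 (k N) x
        change φ 0 x - φ (k N) x ≤ φ 0 x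
        linarith
      _ ≤ ‖φ 0‖ := (le_abs_self _).trans ((φ 0).norm_coe_le_norm x)
  · have h1 := (abs_le.1 (hball y hy i (t (k i)))).1
    have h2 : hP.toBCF (t (k i)) (f i) z
        = hP.toBCF (t (k i)) (φ (k i)) z - hP.toBCF (t (k i)) (φ (k (i + 1))) z := by
      simp_rw [toBCF_apply]
      exact integral_sub (BoundedContinuousFunction.integrable _ _)
        (BoundedContinuousFunction.integrable _ _)
    have h3 := ht (k i)
    have h4 := hnext (k i)
    rw [← hk1] at h4
    linarith

/-! ### Time averages and their ultrafilter limit. -/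

/-- The time average over `[0, n]` of the expectation of `φ` for the process started at `z`. -/
noncomputable def timeAverage (Pstar : ℝ≥0 → ProbabilityMeasure X → ProbabilityMeasure X) (z : X)
    (n : ℕ) (φ : X →ᵇ ℝ) : ℝ :=
  (n : ℝ)⁻¹ * ∫ s in (0 : ℝ)..n, orbit Pstar (diracProb z) φ s

omit [BorelSpace X] in
theorem abs_timeAverage_le {z : X} {φ : X →ᵇ ℝ} {C : ℝ} (hC : 0 ≤ C)
    (h : ∀ s, |orbit Pstar (diracProb z) φ s| ≤ C) (n : ℕ) : |timeAverage Pstar z n φ| ≤ C := by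
  have h1 := intervalIntegral.norm_integral_le_of_norm_le_const (a := 0) (b := n)
    (f := orbit Pstar (diracProb z) φ) (C := C) fun s _ => h s
  rw [timeAverage, abs_mul, abs_of_nonneg (by positivity)]
  rw [sub_zero, Nat.abs_cast] at h1
  calc (n : ℝ)⁻¹ * |∫ s in (0 : ℝ)..n, orbit Pstar (diracProb z) φ s|
      ≤ (n : ℝ)⁻¹ * (C * n) := mul_le_mul_of_nonneg_left h1 (by positivity)
    _ = C * ((n : ℝ)⁻¹ * n) := by ring
    -- An inequality rather than an equality, because the factor is `0` at `n = 0`.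
    _ ≤ C * 1 := mul_le_mul_of_nonneg_left (inv_mul_le_one) hC
    _ = C := mul_one C

/-- Applying `P_r` shifts the time window by `r`; only two end pieces of length `r` fail to cancel,
and dividing by `n` removes them. -/
theorem tendsto_timeAverage_toBCF_sub (hP : IsFellerSemigroup P Pstar) (z : X) (r : ℝ≥0)
    (φ : X →ᵇ ℝ) :
    Tendsto (fun n => timeAverage Pstar z n (hP.toBCF r φ) - timeAverage Pstar z n φ) atTop (𝓝 0) := by
  have hb : ∀ n : ℕ, ‖timeAverage Pstar z n (hP.toBCF r φ) - timeAverage Pstar z n φ‖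
      ≤ (2 * ‖φ‖ * r) * (n : ℝ)⁻¹ := fun n => by
    have hi := hP.intervalIntegrable_orbit (diracProb z) φ
    have hn : ∀ a : ℝ, ‖∫ s in a..(a + r), orbit Pstar (diracProb z) φ s‖ ≤ ‖φ‖ * r := fun a => by
      have := intervalIntegral.norm_integral_le_of_norm_le_const (a := a) (b := a + r)
        (f := orbit Pstar (diracProb z) φ) (C := ‖φ‖) fun s _ => norm_orbit_le _ φ s
      simpa using this
    have e : ∫ s in (r : ℝ)..((n : ℝ) + r), orbit Pstar (diracProb z) φ s
        = (∫ s in (0 : ℝ)..n, orbit Pstar (diracProb z) φ s)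
          + (∫ s in (n : ℝ)..((n : ℝ) + r), orbit Pstar (diracProb z) φ s)
          - ∫ s in (0 : ℝ)..(0 + r), orbit Pstar (diracProb z) φ s := by
      rw [intervalIntegral.integral_add_adjacent_intervals (hi _ _) (hi _ _), zero_add,
        intervalIntegral.integral_interval_sub_left (hi _ _) (hi _ _)]
    rw [timeAverage, timeAverage, hP.integral_orbit_toBCF _ _ n.cast_nonneg, ← mul_sub, norm_mul, e,
      norm_inv, Real.norm_natCast, mul_comm]
    refine mul_le_mul_of_nonneg_right ?_ (by positivity)
    rw [add_sub_assoc, add_sub_cancel_left]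
    refine (norm_sub_le _ _).trans ?_
    linarith [hn n, hn 0]
  refine squeeze_zero_norm hb ?_
  simpa using (tendsto_inv_atTop_nhds_zero_nat (𝕜 := ℝ)).const_mul (2 * ‖φ‖ * r)

/-- Bounded real sequences converge along an ultrafilter, and linearity passes to the limit. -/
theorem exists_limit_timeAverage (hP : IsFellerSemigroup P Pstar) (z : X) :
    ∃ Λ : (X →ᵇ ℝ) →ₗ[ℝ] ℝ, ∀ φ,
      Tendsto (fun n => timeAverage Pstar z n φ) (hyperfilter ℕ) (𝓝 (Λ φ)) := by
  have hex : ∀ φ, ∃ c, Tendsto (fun n => timeAverage Pstar z n φ) (hyperfilter ℕ) (𝓝 c) := fun φ => by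
    have hmem : ∀ n, timeAverage Pstar z n φ ∈ Set.Icc (-‖φ‖) ‖φ‖ := fun n =>
      abs_le.1 (abs_timeAverage_le (norm_nonneg φ) (fun s => norm_orbit_le _ φ s) n)
    obtain ⟨c, _, hc⟩ := (isCompact_Icc (a := -‖φ‖) (b := ‖φ‖)).ultrafilter_le_nhds
      ((hyperfilter ℕ).map fun n => timeAverage Pstar z n φ)
      (tendsto_principal.2 (Eventually.of_forall hmem))
    exact ⟨c, hc⟩
  choose Λ hΛ using hex
  refine ⟨⟨⟨Λ, fun φ ψ => ?_⟩, fun c φ => ?_⟩, hΛ⟩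
  · refine tendsto_nhds_unique (hΛ (φ + ψ)) (((hΛ φ).add (hΛ ψ)).congr fun n => ?_)
    simp only [timeAverage]
    rw [← mul_add, ← intervalIntegral.integral_add (hP.intervalIntegrable_orbit _ _ _ _)
      (hP.intervalIntegrable_orbit _ _ _ _)]
    simp_rw [orbit_add_fun]
  · refine tendsto_nhds_unique (hΛ (c • φ)) (((hΛ φ).const_mul c).congr fun n => ?_)
    simp only [timeAverage]
    simp_rw [orbit_smul]
    rw [intervalIntegral.integral_const_mul]
    ring

theorem eq_of_forall_integral_eq {μ ν : ProbabilityMeasure X}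
    (h : ∀ φ : X →ᵇ ℝ, ∫ x, φ x ∂(μ : Measure X) = ∫ x, φ x ∂(ν : Measure X)) : μ = ν :=
  Subtype.ext <|
    haveI : IsProbabilityMeasure (μ : Measure X) := μ.2
    haveI : IsProbabilityMeasure (ν : Measure X) := ν.2
    ext_of_forall_integral_eq_of_IsFiniteMeasure (μ := (μ : Measure X)) (ν := (ν : Measure X)) h

end IsFellerSemigroup

end Feller

/-! ### Assembly of the invariant measure. -/

open IsFellerSemigroup in
theorem theorem3p5 {X : Type*} [MetricSpace X] [MeasurableSpace X] [BorelSpace X]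
    (P : ℝ≥0 → Bb X →ₗ[ℝ] Bb X)
    (Pstar : ℝ≥0 → ProbabilityMeasure X → ProbabilityMeasure X)
    (hP : IsFellerSemigroup P Pstar)
    (z : X) (μ : ProbabilityMeasure X)
    (hμ : ∀ ε : ℝ, 0 < ε →
      0 < liminf (fun t : ℝ =>
        (1 / t) * ∫ s in (0 : ℝ)..t,
          (Pstar s.toNNReal μ : Measure X).real (Metric.ball z ε)) atTop)
    (hz : ∀ φ : Bb X, Continuous (φ : X → ℝ) →
      EquicontinuousAt (fun (t : ℝ≥0) (x : X) => P t φ x) z) :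
    ∃ ν : ProbabilityMeasure X, ∀ t : ℝ≥0, Pstar t ν = ν := by
  obtain ⟨Λ, hΛ⟩ := hP.exists_limit_timeAverage z
  have hpos : ∀ φ, 0 ≤ φ → 0 ≤ Λ φ := fun φ h => by
    refine ge_of_tendsto' (hΛ φ) fun n => mul_nonneg (by positivity) ?_
    exact intervalIntegral.integral_nonneg n.cast_nonneg fun s _ => orbit_nonneg _ h s
  have hone : Λ 1 = 1 := by
    refine tendsto_nhds_unique (hΛ 1) (tendsto_const_nhds.congr' ?_)
    filter_upwards [Nat.hyperfilter_le_atTop (eventually_gt_atTop 0)] with n hn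
    have hn' : (n : ℝ) ≠ 0 := by exact_mod_cast hn.ne'
    simp [timeAverage, orbit, hn']
  have hσ : ∀ φ : ℕ → X →ᵇ ℝ, Antitone φ → (∀ x, Tendsto (fun n => φ n x) atTop (𝓝 0)) →
      Tendsto (fun n => Λ (φ n)) atTop (𝓝 0) := by
    intro φ hφ hlim
    have hφ0 : ∀ n, 0 ≤ φ n := fun n x =>
      Antitone.le_of_tendsto (f := fun n => φ n x) (fun _ _ h => hφ h x) (hlim x) n
    rw [Metric.tendsto_atTop]
    intro δ hδ
    obtain ⟨N, hN⟩ := hP.exists_forall_toBCF_lt hμ hz hφ hlim (half_pos hδ)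
    refine ⟨N, fun n hn => ?_⟩
    -- The bound at `z` is uniform in time, so it survives averaging and the ultrafilter limit.
    have hle : Λ (φ n) ≤ δ / 2 := by
      refine (DaniellRepresentation.map_mono hpos (hφ hn)).trans (le_of_tendsto' (hΛ _) fun m => ?_)
      refine (le_abs_self _).trans (abs_timeAverage_le (half_pos hδ).le (fun s => ?_) m)
      rw [abs_of_nonneg (orbit_nonneg _ (hφ0 N) s), orbit, ← hP.toBCF_apply]
      exact (hN _).le
    rw [Real.dist_eq, sub_zero, abs_of_nonneg (hpos _ (hφ0 n))]
    linarith
  obtain ⟨ν, hν⟩ := DaniellRepresentation.exists_probabilityMeasure hpos hone hσ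
  refine ⟨ν, fun t => eq_of_forall_integral_eq fun φ => ?_⟩
  rw [← hP.integral_toBCF, hν, hν]
  have h := tendsto_nhds_unique ((hΛ (hP.toBCF t φ)).sub (hΛ φ))
    ((hP.tendsto_timeAverage_toBCF_sub z t φ).mono_left Nat.hyperfilter_le_atTop)
  linarith
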